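/- All Banach spaces are over a fixed scalar field $\mathbb K\in\{\mathbb R,\mathbb C\}$. For Banach spaces $U,V$ let $\mathcal A(U,V)$ be the Banach space of approximable operators, i.e. the closure, in the operator norm, of the bounded finite-rank operators $U\to V$, and let $\mathcal A(U)=\mathcal A(U,U)$, a Banach algebra under composition. Let $\widehat\otimes$ denote the completed projective tensor product. A Banach algebra $\mathcal B$ is called $K$-amenable if there is a net $(d_\alpha)$ in $\mathcal B\widehat\otimes\mathcal B$ with $\|d_\alpha\|\le K$ for all $\alpha$ such that $\pi(d_\alpha)a\to a$ and $a\cdot d_\alpha-d_\alpha\cdot a\to 0$ for every $a\in\mathcal B$, where $\pi(b\otimes c)=bc$, $a\cdot(b\otimes c)=ab\otimes c$ and $(b\otimes c)\cdot a=b\otimes ca$. The inversion constant of a bounded linear surjection $Q:E\to F$ of Banach spaces is $\|\widetilde Q^{-1}\|$, where $\widetilde Q:E/\ker Q\to F$ is the induced isomorphism. Let $X$ be a Banach space such that $\mathcal A(X)$ is $K$-amenable, let $P:X\to X$ be a bounded projection, and set $Y=\operatorname{rg}P$ and $Z=\operatorname{rg}(I-P)$. Then at least one of the product maps $$\pi_1:\mathcal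 A(Z,Y)\widehat\otimes\mathcal A(Y,Z)\to\mathcal A(Y),\qquad \pi_2:\mathcal A(Y,Z)\widehat\otimes\mathcal A(Z,Y)\to\mathcal A(Z),\qquad R\otimes S\mapsto RS,$$ is surjective with inversion constant at most $$4K\,\|P\|\,\|I-P\|\,\max\{\|P\|^3,\|I-P\|^3\}.$$ -/

import Mathlib

open scoped TensorProduct

noncomputable section

namespace ApproxOp

/-! ### The projective tensor product of two normed spaces -/

section Projective

variable (𝕜 : Type*) [RCLike 𝕜]
variable (E : Type*) [NormedAddCommGroup E] [NormedSpace 𝕜 E]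
variable (F : Type*) [NormedAddCommGroup F] [NormedSpace 𝕜 F]

/-- The algebraic tensor product `E ⊗ F`, as a type of its own that carries the projective norm. -/
def AlgTensor : Type _ := E ⊗[𝕜] F

instance : AddCommGroup (AlgTensor 𝕜 E F) := inferInstanceAs (AddCommGroup (E ⊗[𝕜] F))

instance : Module 𝕜 (AlgTensor 𝕜 E F) := inferInstanceAs (Module 𝕜 (E ⊗[𝕜] F))

variable {E F}

/-- The element `∑ xᵢ ⊗ yᵢ` given by a finite list of pairs `(xᵢ, yᵢ)`. -/
def tensorSum (l : List (E × F)) : AlgTensor 𝕜 E F :=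
  (l.map fun p => (p.1 ⊗ₜ[𝕜] p.2 : E ⊗[𝕜] F)).sum

/-- The cost `∑ ‖xᵢ‖ ‖yᵢ‖` of a finite list of pairs `(xᵢ, yᵢ)`. -/
def tensorCost (l : List (E × F)) : ℝ :=
  (l.map fun p => ‖p.1‖ * ‖p.2‖).sum

variable {𝕜}

/-- The projective norm: the infimum of `∑ ‖xᵢ‖ ‖yᵢ‖` over all representations
`t = ∑ xᵢ ⊗ yᵢ`. -/
def projNorm (t : AlgTensor 𝕜 E F) : ℝ :=
  ⨅ l : {l : List (E × F) // tensorSum 𝕜 l = t}, tensorCost l.1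

theorem tensorCost_nonneg (l : List (E × F)) : 0 ≤ tensorCost l := by
  refine List.sum_nonneg fun a ha => ?_
  obtain ⟨p, -, rfl⟩ := List.mem_map.1 ha
  positivity

theorem bddBelow_tensorCost (t : AlgTensor 𝕜 E F) :
    BddBelow (Set.range fun l : {l : List (E × F) // tensorSum 𝕜 l = t} => tensorCost l.1) :=
  ⟨0, by rintro _ ⟨l, rfl⟩; exact tensorCost_nonneg _⟩

theorem tensorSum_append (l m : List (E × F)) :
    tensorSum 𝕜 (l ++ m) = tensorSum 𝕜 l + tensorSum 𝕜 m := by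
  unfold tensorSum
  rw [List.map_append, List.sum_append]
  rfl

theorem tensorSum_smul (c : 𝕜) (l : List (E × F)) :
    tensorSum 𝕜 (l.map fun p => (c • p.1, p.2)) = c • tensorSum 𝕜 l := by
  induction l with
  | nil => exact (smul_zero (A := AlgTensor 𝕜 E F) c).symm
  | cons p l ih =>
    have h1 : tensorSum 𝕜 ((p :: l).map fun p => (c • p.1, p.2))
        = tensorSum 𝕜 [(c • p.1, p.2)] + tensorSum 𝕜 (l.map fun p => (c • p.1, p.2)) :=
      tensorSum_append [(c • p.1, p.2)] _
    have h2 : tensorSum 𝕜 (p :: l) = tensorSum 𝕜 [p] + tensorSum 𝕜 l := tensorSum_append [p] l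
    have h3 : tensorSum 𝕜 [(c • p.1, p.2)] = c • tensorSum 𝕜 [p] := by
      have : (((c • p.1) ⊗ₜ[𝕜] p.2 : E ⊗[𝕜] F) + 0) = c • ((p.1 ⊗ₜ[𝕜] p.2 : E ⊗[𝕜] F) + 0) := by
        rw [add_zero, add_zero, TensorProduct.smul_tmul']
      exact this
    rw [h1, h2, ih, h3, smul_add]

theorem exists_tensorSum (t : AlgTensor 𝕜 E F) : ∃ l : List (E × F), tensorSum 𝕜 l = t := by
  refine TensorProduct.induction_on (R := 𝕜) (M := E) (N := F)
    (motive := fun t => ∃ l : List (E × F), tensorSum 𝕜 l = t) t ⟨[], rfl⟩ ?_ ?_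
  · intro x y
    exact ⟨[(x, y)], add_zero (x ⊗ₜ[𝕜] y : E ⊗[𝕜] F)⟩
  · rintro x y ⟨l, rfl⟩ ⟨m, rfl⟩
    exact ⟨l ++ m, tensorSum_append l m⟩

instance (t : AlgTensor 𝕜 E F) : Nonempty {l : List (E × F) // tensorSum 𝕜 l = t} :=
  let ⟨l, hl⟩ := exists_tensorSum t
  ⟨⟨l, hl⟩⟩

theorem projNorm_le_cost (l : List (E × F)) : projNorm (tensorSum 𝕜 l) ≤ tensorCost l :=
  ciInf_le (bddBelow_tensorCost _) ⟨l, rfl⟩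

theorem projNorm_zero : projNorm (0 : AlgTensor 𝕜 E F) = 0 :=
  le_antisymm (projNorm_le_cost (𝕜 := 𝕜) ([] : List (E × F)))
    (le_ciInf fun l => tensorCost_nonneg l.1)

theorem projNorm_add_le (s t : AlgTensor 𝕜 E F) :
    projNorm (s + t) ≤ projNorm s + projNorm t := by
  refine le_ciInf_add_ciInf fun l m => ?_
  have h : tensorSum 𝕜 (l.1 ++ m.1) = s + t := by rw [tensorSum_append, l.2, m.2]
  refine (ciInf_le (bddBelow_tensorCost _) ⟨l.1 ++ m.1, h⟩).trans (le_of_eq ?_)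
  simp [tensorCost]

theorem projNorm_smul_le (c : 𝕜) (t : AlgTensor 𝕜 E F) :
    projNorm (c • t) ≤ ‖c‖ * projNorm t := by
  unfold projNorm
  rw [Real.mul_iInf_of_nonneg (norm_nonneg _)]
  refine le_ciInf fun l => ?_
  have h : tensorSum 𝕜 (l.1.map fun p => (c • p.1, p.2)) = c • t := by
    rw [tensorSum_smul, l.2]
  refine (ciInf_le (bddBelow_tensorCost _) ⟨_, h⟩).trans (le_of_eq ?_)
  simp [tensorCost, Function.comp_def, norm_smul, mul_assoc, List.sum_map_mul_left]

variable (𝕜 E F) in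
/-- The projective norm as a seminorm on `E ⊗ F`. -/
def projSeminorm : Seminorm 𝕜 (AlgTensor 𝕜 E F) :=
  .ofSMulLE projNorm projNorm_zero projNorm_add_le projNorm_smul_le

instance : SeminormedAddCommGroup (AlgTensor 𝕜 E F) :=
  fast_instance% AddGroupSeminorm.toSeminormedAddCommGroup (projSeminorm 𝕜 E F).toAddGroupSeminorm

instance : NormedSpace 𝕜 (AlgTensor 𝕜 E F) := ⟨projNorm_smul_le⟩

variable (𝕜 E F) in
/-- The (completed) projective tensor product `E ⊗̂ F`: the completion of `E ⊗ F` for the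
projective norm. -/
def ProjTensor : Type _ := UniformSpace.Completion (AlgTensor 𝕜 E F)

instance : NormedAddCommGroup (ProjTensor 𝕜 E F) :=
  inferInstanceAs (NormedAddCommGroup (UniformSpace.Completion (AlgTensor 𝕜 E F)))

instance : NormedSpace 𝕜 (ProjTensor 𝕜 E F) :=
  inferInstanceAs (NormedSpace 𝕜 (UniformSpace.Completion (AlgTensor 𝕜 E F)))

instance : CompleteSpace (ProjTensor 𝕜 E F) :=
  inferInstanceAs (CompleteSpace (UniformSpace.Completion (AlgTensor 𝕜 E F)))

variable (𝕜 E F) in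
/-- The canonical (isometric, dense) map `E ⊗ F → E ⊗̂ F`. -/
def toProj : AlgTensor 𝕜 E F →L[𝕜] ProjTensor 𝕜 E F :=
  UniformSpace.Completion.toComplL (𝕜 := 𝕜) (E := AlgTensor 𝕜 E F)

theorem denseRange_toProj : DenseRange (toProj 𝕜 E F) :=
  UniformSpace.Completion.denseRange_coe (α := AlgTensor 𝕜 E F)

theorem isUniformInducing_toProj : IsUniformInducing (toProj 𝕜 E F) :=
  UniformSpace.Completion.isUniformInducing_coe (AlgTensor 𝕜 E F)

theorem norm_toProj (t : AlgTensor 𝕜 E F) : ‖toProj 𝕜 E F t‖ = projNorm t :=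
  UniformSpace.Completion.norm_coe (E := AlgTensor 𝕜 E F) t

variable (𝕜 E F) in
/-- The canonical bilinear map `E × F → E ⊗ F`. -/
def algMk : E →ₗ[𝕜] F →ₗ[𝕜] AlgTensor 𝕜 E F := TensorProduct.mk 𝕜 E F

theorem tensorSum_singleton (x : E) (y : F) : tensorSum 𝕜 [(x, y)] = algMk 𝕜 E F x y :=
  add_zero (x ⊗ₜ[𝕜] y : E ⊗[𝕜] F)

variable (𝕜) in
/-- The elementary tensor `x ⊗ y` in `E ⊗̂ F`. -/
def ptmul (x : E) (y : F) : ProjTensor 𝕜 E F := toProj 𝕜 E F (algMk 𝕜 E F x y)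

variable {G : Type*} [NormedAddCommGroup G] [NormedSpace 𝕜 G]

/-- The linear map on `E ⊗ F` induced by a bounded bilinear map. -/
def algLift (B : E →L[𝕜] F →L[𝕜] G) : AlgTensor 𝕜 E F →ₗ[𝕜] G :=
  TensorProduct.lift (B.toLinearMap₁₂ : E →ₗ[𝕜] F →ₗ[𝕜] G)

theorem algLift_tensorSum (B : E →L[𝕜] F →L[𝕜] G) (l : List (E × F)) :
    algLift B (tensorSum 𝕜 l) = (l.map fun p => B p.1 p.2).sum := by
  induction l with
  | nil => exact map_zero (algLift B)
  | cons p l ih =>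
    have h : tensorSum 𝕜 (p :: l) = tensorSum 𝕜 [p] + tensorSum 𝕜 l := tensorSum_append [p] l
    have h1 : algLift B (tensorSum 𝕜 [p]) = B p.1 p.2 := by
      have : TensorProduct.lift (B.toLinearMap₁₂ : E →ₗ[𝕜] F →ₗ[𝕜] G)
          ((p.1 ⊗ₜ[𝕜] p.2 : E ⊗[𝕜] F) + 0) = B p.1 p.2 := by
        rw [add_zero, TensorProduct.lift.tmul]; rfl
      exact this
    rw [h, map_add, ih, h1, List.map_cons, List.sum_cons]

theorem norm_algLift_le (B : E →L[𝕜] F →L[𝕜] G) (t : AlgTensor 𝕜 E F) :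
    ‖algLift B t‖ ≤ ‖B‖ * ‖t‖ := by
  change ‖algLift B t‖ ≤ ‖B‖ * projNorm t
  unfold projNorm
  rw [Real.mul_iInf_of_nonneg (norm_nonneg B)]
  refine le_ciInf ?_
  rintro ⟨l, rfl⟩
  rw [algLift_tensorSum]
  induction l with
  | nil => simp [tensorCost]
  | cons p l ih =>
    have h := B.le_opNorm₂ p.1 p.2
    simp only [tensorCost, List.map_cons, List.sum_cons] at ih ⊢
    calc _ ≤ ‖B p.1 p.2‖ + ‖(l.map fun p => B p.1 p.2).sum‖ := norm_add_le _ _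
      _ ≤ _ := by rw [mul_add, ← mul_assoc]; exact add_le_add h ih

/-- The bounded linear map `E ⊗̂ F → G` into a Banach space `G` induced by a bounded bilinear map
`B : E × F → G`; it sends `x ⊗ y` to `B x y`. -/
def lift [CompleteSpace G] (B : E →L[𝕜] F →L[𝕜] G) : ProjTensor 𝕜 E F →L[𝕜] G :=
  ((algLift B).mkContinuous ‖B‖ (norm_algLift_le B)).extend (toProj 𝕜 E F)

theorem lift_ptmul [CompleteSpace G] (B : E →L[𝕜] F →L[𝕜] G) (x : E) (y : F) :
    lift B (ptmul 𝕜 x y) = B x y :=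
  (ContinuousLinearMap.extend_eq _ denseRange_toProj isUniformInducing_toProj _).trans
    (TensorProduct.lift.tmul (R := 𝕜) x y)

theorem norm_ptmul_le (x : E) (y : F) : ‖ptmul 𝕜 x y‖ ≤ ‖x‖ * ‖y‖ := by
  have h := projNorm_le_cost (𝕜 := 𝕜) [(x, y)]
  rw [tensorSum_singleton] at h
  rw [ptmul, norm_toProj]
  simpa [tensorCost] using h

variable (𝕜 E F) in
/-- The canonical bounded bilinear map `E × F → E ⊗̂ F`, `(x, y) ↦ x ⊗ y`. -/
def ptmulL : E →L[𝕜] F →L[𝕜] ProjTensor 𝕜 E F :=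
  LinearMap.mkContinuous₂ ((algMk 𝕜 E F).compr₂ (toProj 𝕜 E F : AlgTensor 𝕜 E F →ₗ[𝕜] _))
    1 fun x y => by rw [one_mul]; exact norm_ptmul_le x y

theorem ptmulL_apply (x : E) (y : F) : ptmulL 𝕜 E F x y = ptmul 𝕜 x y := rfl

end Projective

/-! ### Amenability -/

section Amenable

variable (𝕜 : Type*) [RCLike 𝕜]
variable {A : Type*} [NonUnitalNormedRing A] [NormedSpace 𝕜 A] [IsScalarTower 𝕜 A A]
  [SMulCommClass 𝕜 A A]

/-- The left action `a · (b ⊗ c) = ab ⊗ c` of `A` on `A ⊗̂ A`. -/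
def leftAct (a : A) : ProjTensor 𝕜 A A →L[𝕜] ProjTensor 𝕜 A A :=
  lift ((ptmulL 𝕜 A A).comp (ContinuousLinearMap.mul 𝕜 A a))

/-- The right action `(b ⊗ c) · a = b ⊗ ca` of `A` on `A ⊗̂ A`. -/
def rightAct (a : A) : ProjTensor 𝕜 A A →L[𝕜] ProjTensor 𝕜 A A :=
  lift ((ptmulL 𝕜 A A).bilinearComp (.id 𝕜 A) ((ContinuousLinearMap.mul 𝕜 A).flip a))

variable (A) in
/-- The product map `π : A ⊗̂ A → A`, `a ⊗ b ↦ ab`. -/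
def mulMap [CompleteSpace A] : ProjTensor 𝕜 A A →L[𝕜] A :=
  lift (ContinuousLinearMap.mul 𝕜 A)

theorem leftAct_ptmul (a b c : A) : leftAct 𝕜 a (ptmul 𝕜 b c) = ptmul 𝕜 (a * b) c :=
  lift_ptmul _ b c

theorem rightAct_ptmul (a b c : A) : rightAct 𝕜 a (ptmul 𝕜 b c) = ptmul 𝕜 b (c * a) :=
  lift_ptmul _ b c

end Amenable

/-- The Banach algebra `A` is `K`-amenable: it has an approximate diagonal of bound `K`, i.e. a net
`(d i)` in `A ⊗̂ A` with `‖d i‖ ≤ K`, `π (d i) a → a` and `a · d i - d i · a → 0` for all `a`. -/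
def IsKAmenable.{u, v} (𝕜 : Type u) [RCLike 𝕜] (A : Type v) [NonUnitalNormedRing A]
    [NormedSpace 𝕜 A] [IsScalarTower 𝕜 A A] [SMulCommClass 𝕜 A A] [CompleteSpace A]
    (K : ℝ) : Prop :=
  ∃ (ι : Type v) (_ : Preorder ι) (_ : IsDirectedOrder ι) (_ : Nonempty ι)
    (d : ι → ProjTensor 𝕜 A A),
    (∀ i, ‖d i‖ ≤ K) ∧
    (∀ a : A, Filter.Tendsto (fun i => mulMap 𝕜 A (d i) * a) Filter.atTop (nhds a)) ∧
    (∀ a : A, Filter.Tendsto (fun i => leftAct 𝕜 a (d i) - rightAct 𝕜 a (d i)) Filter.atTop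
      (nhds 0))

/-! ### Approximable operators -/

section Approximable

variable (𝕜 : Type*) [RCLike 𝕜]
variable (X : Type*) [NormedAddCommGroup X] [NormedSpace 𝕜 X]
variable (Y : Type*) [NormedAddCommGroup Y] [NormedSpace 𝕜 Y]
variable (Z : Type*) [NormedAddCommGroup Z] [NormedSpace 𝕜 Z]

/-- The space `F(X, Y)` of bounded finite-rank operators. -/
def finiteRank : Submodule 𝕜 (X →L[𝕜] Y) where
  carrier := {T | FiniteDimensional 𝕜 (LinearMap.range (T : X →ₗ[𝕜] Y))}
  zero_mem' := by
    have h : LinearMap.range ((0 : X →L[𝕜] Y) : X →ₗ[𝕜] Y) = ⊥ := by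
      rw [ContinuousLinearMap.toLinearMap_zero, LinearMap.range_zero]
    simp only [Set.mem_ofPred_eq]
    rw [h]
    infer_instance
  add_mem' := by
    intro S T hS hT
    simp only [Set.mem_ofPred_eq] at hS hT ⊢
    refine Submodule.finiteDimensional_of_le (S₂ := LinearMap.range (S : X →ₗ[𝕜] Y) ⊔
      LinearMap.range (T : X →ₗ[𝕜] Y)) ?_
    rintro _ ⟨x, rfl⟩
    exact Submodule.add_mem_sup ⟨x, rfl⟩ ⟨x, rfl⟩
  smul_mem' := by
    intro c T hT
    simp only [Set.mem_ofPred_eq] at hT ⊢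
    refine Submodule.finiteDimensional_of_le (S₂ := LinearMap.range (T : X →ₗ[𝕜] Y)) ?_
    rintro _ ⟨x, rfl⟩
    exact Submodule.smul_mem _ c ⟨x, rfl⟩

/-- The space `A(X, Y)` of approximable operators: the operator norm closure of `F(X, Y)`. -/
def approximable : Submodule 𝕜 (X →L[𝕜] Y) := (finiteRank 𝕜 X Y).topologicalClosure

variable {𝕜 X Y Z}

theorem comp_mem_approximable_left (R : Y →L[𝕜] Z) {S : X →L[𝕜] Y}
    (hS : S ∈ approximable 𝕜 X Y) : R.comp S ∈ approximable 𝕜 X Z := by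
  have hc : Continuous fun S : X →L[𝕜] Y => R.comp S :=
    (ContinuousLinearMap.compL 𝕜 X Y Z R).continuous
  refine map_mem_closure hc hS fun S hS => ?_
  have hS' : FiniteDimensional 𝕜 (LinearMap.range (S : X →ₗ[𝕜] Y)) := hS
  change FiniteDimensional 𝕜 (LinearMap.range ((R : Y →ₗ[𝕜] Z) ∘ₗ (S : X →ₗ[𝕜] Y)))
  rw [LinearMap.range_comp]
  infer_instance

variable (𝕜 X Y) in
/-- The Banach space `A(X, Y)` of approximable operators with the operator norm, as a type. -/
def Approx : Type _ := approximable 𝕜 X Y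

instance : NormedAddCommGroup (Approx 𝕜 X Y) :=
  inferInstanceAs (NormedAddCommGroup (approximable 𝕜 X Y))

instance : NormedSpace 𝕜 (Approx 𝕜 X Y) :=
  inferInstanceAs (NormedSpace 𝕜 (approximable 𝕜 X Y))

instance [CompleteSpace Y] : CompleteSpace (Approx 𝕜 X Y) :=
  (Submodule.isClosed_topologicalClosure (finiteRank 𝕜 X Y)).completeSpace_coe

variable (𝕜 X Y) in
/-- The isometric inclusion of `A(X, Y)` into the bounded operators. -/
def Approx.val : Approx 𝕜 X Y →ₗᵢ[𝕜] (X →L[𝕜] Y) := (approximable 𝕜 X Y).subtypeₗᵢ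

theorem Approx.val_injective : Function.Injective (Approx.val 𝕜 X Y) :=
  (Approx.val 𝕜 X Y).injective

/-- Composition of approximable operators. -/
def Approx.comp (R : Approx 𝕜 Y Z) (S : Approx 𝕜 X Y) : Approx 𝕜 X Z :=
  ⟨(Approx.val 𝕜 Y Z R).comp (Approx.val 𝕜 X Y S), comp_mem_approximable_left _ S.2⟩

theorem Approx.val_comp (R : Approx 𝕜 Y Z) (S : Approx 𝕜 X Y) :
    Approx.val 𝕜 X Z (R.comp S) = (Approx.val 𝕜 Y Z R).comp (Approx.val 𝕜 X Y S) := rfl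

/-- `A(X) = A(X, X)` is a Banach algebra, with composition as multiplication. -/
instance : NonUnitalNormedRing (Approx 𝕜 X X) where
  __ := (inferInstance : NormedAddCommGroup (Approx 𝕜 X X))
  mul := Approx.comp
  left_distrib R S T := Approx.val_injective <| by
    change Approx.val 𝕜 X X (R.comp (S + T)) = Approx.val 𝕜 X X (R.comp S + R.comp T)
    simp [Approx.val_comp]
  right_distrib R S T := Approx.val_injective <| by
    change Approx.val 𝕜 X X ((R + S).comp T) = Approx.val 𝕜 X X (R.comp T + S.comp T)
    simp [Approx.val_comp]
  zero_mul R := Approx.val_injective <| by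
    change Approx.val 𝕜 X X (Approx.comp 0 R) = Approx.val 𝕜 X X 0
    simp [Approx.val_comp]
  mul_zero R := Approx.val_injective <| by
    change Approx.val 𝕜 X X (Approx.comp R 0) = Approx.val 𝕜 X X 0
    simp [Approx.val_comp]
  mul_assoc _ _ _ := rfl
  norm_mul_le R S := ContinuousLinearMap.opNorm_comp_le R.1 S.1

theorem Approx.mul_eq_comp (R S : Approx 𝕜 X X) : R * S = R.comp S := rfl

instance : IsScalarTower 𝕜 (Approx 𝕜 X X) (Approx 𝕜 X X) where
  smul_assoc c R S := Approx.val_injective <| by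
    rw [smul_eq_mul, smul_eq_mul, map_smul, Approx.mul_eq_comp, Approx.mul_eq_comp,
      Approx.val_comp, Approx.val_comp, map_smul, ContinuousLinearMap.smul_comp]

instance : SMulCommClass 𝕜 (Approx 𝕜 X X) (Approx 𝕜 X X) where
  smul_comm c R S := Approx.val_injective <| by
    rw [smul_eq_mul, smul_eq_mul, map_smul, Approx.mul_eq_comp, Approx.mul_eq_comp,
      Approx.val_comp, Approx.val_comp, map_smul, ContinuousLinearMap.comp_smul]

variable (𝕜 Y Z) in
/-- Composition `(R, S) ↦ R ∘ S` as a bounded bilinear map `A(Z, Y) × A(Y, Z) → A(Y)`. -/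
def compApprox : Approx 𝕜 Z Y →L[𝕜] Approx 𝕜 Y Z →L[𝕜] Approx 𝕜 Y Y :=
  LinearMap.mkContinuous₂
    (LinearMap.mk₂ 𝕜 Approx.comp
      (fun R R' S => Approx.val_injective (by simp [Approx.val_comp]))
      (fun c R S => Approx.val_injective (by simp [Approx.val_comp]))
      (fun R S S' => Approx.val_injective (by simp [Approx.val_comp]))
      (fun c R S => Approx.val_injective (by simp [Approx.val_comp])))
    1 fun R S => by
      rw [one_mul, LinearMap.mk₂_apply, ← (Approx.val 𝕜 Y Y).norm_map,
        ← (Approx.val 𝕜 Z Y).norm_map, ← (Approx.val 𝕜 Y Z).norm_map, Approx.val_comp]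
      exact ContinuousLinearMap.opNorm_comp_le _ _

variable (𝕜 Y Z) in
/-- The product map `π : A(Z, Y) ⊗̂ A(Y, Z) → A(Y)`, `R ⊗ S ↦ R ∘ S`. -/
def productMap [CompleteSpace Y] :
    ProjTensor 𝕜 (Approx 𝕜 Z Y) (Approx 𝕜 Y Z) →L[𝕜] Approx 𝕜 Y Y :=
  lift (compApprox 𝕜 Y Z)

theorem productMap_ptmul [CompleteSpace Y] (R : Approx 𝕜 Z Y) (S : Approx 𝕜 Y Z) :
    productMap 𝕜 Y Z (ptmul 𝕜 R S) = R.comp S :=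
  lift_ptmul (compApprox 𝕜 Y Z) R S

end Approximable

/-! ### Inversion constants, and ranges of projections -/

section Inversion

variable {𝕜 : Type*} [RCLike 𝕜]
variable {E : Type*} [NormedAddCommGroup E] [NormedSpace 𝕜 E] [CompleteSpace E]
variable {F : Type*} [NormedAddCommGroup F] [NormedSpace 𝕜 F] [CompleteSpace F]

/-- The inverse `F → E ⧸ ker Q` of the linear isomorphism induced by a bounded surjection
`Q : E → F` of Banach spaces; it is bounded by the open mapping theorem. -/
def quotientInverse (Q : E →L[𝕜] F) (hQ : Function.Surjective Q) :
    F →L[𝕜] E ⧸ LinearMap.ker (Q : E →ₗ[𝕜] F) :=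
  LinearMap.mkContinuousOfExistsBound
    ((Q : E →ₗ[𝕜] F).quotKerEquivOfSurjective hQ).symm.toLinearMap <| by
      obtain ⟨C, -, hC⟩ := Q.exists_preimage_norm_le hQ
      refine ⟨C, fun y => ?_⟩
      obtain ⟨x, rfl, hx⟩ := hC y
      have h : ((Q : E →ₗ[𝕜] F).quotKerEquivOfSurjective hQ).symm (Q x) = Submodule.Quotient.mk x :=
        (Q : E →ₗ[𝕜] F).quotKerEquivOfSurjective_symm_apply hQ x
      change ‖((Q : E →ₗ[𝕜] F).quotKerEquivOfSurjective hQ).symm (Q x)‖ ≤ _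
      rw [h]
      exact (Submodule.Quotient.norm_mk_le _ x).trans hx

/-- The inversion constant of a bounded surjection `Q : E → F` of Banach spaces: the operator norm
of the inverse of the induced isomorphism `E ⧸ ker Q → F`. -/
def inversionConstant (Q : E →L[𝕜] F) (hQ : Function.Surjective Q) : ℝ :=
  ‖quotientInverse Q hQ‖

/-- The range of a bounded linear map, as a normed space. -/
abbrev rg (P : E →L[𝕜] E) : Submodule 𝕜 E := LinearMap.range (P : E →ₗ[𝕜] E)

theorem completeSpace_rg {P : E →L[𝕜] E} (hP : IsIdempotentElem P) : CompleteSpace (rg P) := by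
  have h : (rg P : Set E) = {x | P x = x} := by
    ext x
    constructor
    · rintro ⟨y, rfl⟩
      exact DFunLike.congr_fun hP.eq y
    · intro hx
      exact ⟨x, hx⟩
  have hc : IsClosed (rg P : Set E) := by
    rw [h]
    exact isClosed_eq P.continuous continuous_id
  exact hc.completeSpace_coe

end Inversion

end ApproxOp

end

/-! Let `d i` be an approximate diagonal of `A(X)`. For a bounded operator `T`, the map a ⊗ b ↦ aTb
(`middle T`) sends `d i` to a bounded family of operators that asymptotically commutes with every
approximable operator. Testing against rank-one operators shows that, along an ultrafilter, this
family converges pointwise to a scalar multiple of the identity (`exists_tendsto_middle_apply`). Let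
c and c' be the scalars for T = P and T = 1 - P. For T = 1 the family is π(d i), which converges
pointwise to the identity, so c + c' = 1 and one of the two scalars has modulus at least 1/2.

Suppose it is c'. Each elementary term a(1 - P)b factors through Z. Compressing to Y and composing
with a given operator in A(Y) therefore gives a product of an element of A(Z, Y) and one of A(Y, Z).
Pointwise convergence of a bounded family becomes norm convergence after composition with an
approximable operator (`tendsto_comp_of_tendsto_apply`), so division by c' yields approximate
preimages under the product map, with norm control 2K‖P‖‖1 - P‖
(`exists_inversionConstant_productMap_le`). Completeness turns these into surjectivity, and
continuity of the quotient inverse keeps the constant. If c is the large scalar, Y and Z exchange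
roles. -/

open scoped TensorProduct Topology

noncomputable section

namespace ApproxOp

/-! ### Bounded maps on the projective tensor product -/

section Projective

variable {𝕜 : Type*} [RCLike 𝕜]
variable {E : Type*} [NormedAddCommGroup E] [NormedSpace 𝕜 E]
variable {F : Type*} [NormedAddCommGroup F] [NormedSpace 𝕜 F]
variable {G : Type*} [NormedAddCommGroup G] [NormedSpace 𝕜 G]

/-- Bounded linear maps on `E ⊗̂ F` are determined by their values on elementary tensors. -/
theorem projTensor_ext {f g : ProjTensor 𝕜 E F →L[𝕜] G}
    (h : ∀ x y, f (ptmul 𝕜 x y) = g (ptmul 𝕜 x y)) : f = g := by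
  refine ContinuousLinearMap.coeFn_injective
    (denseRange_toProj.equalizer f.continuous g.continuous (funext fun t => ?_))
  obtain ⟨l, rfl⟩ := exists_tensorSum t
  induction l with
  | nil =>
    have h0 : tensorSum 𝕜 ([] : List (E × F)) = 0 := rfl
    simp [h0]
  | cons p l ih =>
    have h1 : tensorSum 𝕜 (p :: l) = algMk 𝕜 E F p.1 p.2 + tensorSum 𝕜 l :=
      (tensorSum_append [p] l).trans (by rw [tensorSum_singleton])
    have h2 := h p.1 p.2
    simp only [Function.comp_apply, ptmul] at ih h2 ⊢
    rw [h1, map_add, map_add, map_add, ih, h2]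

theorem norm_lift_apply_le [CompleteSpace G] (B : E →L[𝕜] F →L[𝕜] G) (t : ProjTensor 𝕜 E F) :
    ‖lift B t‖ ≤ ‖B‖ * ‖t‖ := by
  refine denseRange_toProj.induction_on t
    (isClosed_le (by fun_prop) (by fun_prop)) fun s => ?_
  have h : lift B (toProj 𝕜 E F s) = algLift B s :=
    ContinuousLinearMap.extend_eq _ denseRange_toProj isUniformInducing_toProj _
  rw [h, norm_toProj]
  exact norm_algLift_le B s

end Projective

/-! ### Almost surjective maps -/

section Inversion

variable {𝕜 : Type*} [RCLike 𝕜]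
variable {E : Type*} [NormedAddCommGroup E] [NormedSpace 𝕜 E] [CompleteSpace E]
variable {F : Type*} [NormedAddCommGroup F] [NormedSpace 𝕜 F]

/-- Successive approximation, as in the open mapping theorem: each correction halves the residual,
and the corrections sum absolutely because `E` is complete. -/
theorem surjective_of_approx_preimage (Q : E →L[𝕜] F) (C : ℝ)
    (h : ∀ y, ∀ δ > 0, ∃ x, ‖x‖ ≤ C * ‖y‖ ∧ ‖y - Q x‖ < δ) : Function.Surjective Q := by
  have h' : ∀ y, ∃ x, ‖x‖ ≤ C * ‖y‖ ∧ ‖y - Q x‖ ≤ 1 / 2 * ‖y‖ := by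
    intro y
    rcases eq_or_ne y 0 with rfl | hy
    · exact ⟨0, by simp⟩
    · obtain ⟨x, h1, h2⟩ := h y (1 / 2 * ‖y‖) (by positivity)
      exact ⟨x, h1, h2.le⟩
  choose g hg hg' using h'
  intro y
  -- Residuals: `r n` is what is left of `y` after `n` corrections.
  let r : ℕ → F := fun n => (fun z => z - Q (g z))^[n] y
  have hr1 : ∀ n, r (n + 1) = r n - Q (g (r n)) := fun n => Function.iterate_succ_apply' _ _ _
  have hr : ∀ n, ‖r n‖ ≤ (1 / 2) ^ n * ‖y‖ := by
    intro n
    induction n with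
    | zero => simp [r]
    | succ n ih =>
      rw [hr1, pow_succ']
      linarith [hg' (r n)]
  have hC : ∀ n, ‖g (r n)‖ ≤ (1 / 2) ^ n * (|C| * ‖y‖) := fun n =>
    calc ‖g (r n)‖ ≤ C * ‖r n‖ := hg _
      _ ≤ |C| * ‖r n‖ := by gcongr; exact le_abs_self C
      _ ≤ |C| * ((1 / 2) ^ n * ‖y‖) := by gcongr; exact hr n
      _ = _ := by ring
  have hs : Summable fun n => g (r n) :=
    .of_norm_bounded (summable_geometric_two.mul_right _) hC
  have hsum : ∀ n, ∑ i ∈ Finset.range n, Q (g (r i)) = y - r n := by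
    intro n
    induction n with
    | zero => simp [r]
    | succ n ih => rw [Finset.sum_range_succ, ih, hr1]; abel
  have hr0 : Filter.Tendsto r Filter.atTop (𝓝 0) := by
    refine squeeze_zero_norm hr ?_
    simpa using (tendsto_pow_atTop_nhds_zero_of_lt_one (r := (1 / 2 : ℝ)) (by norm_num)
      (by norm_num)).mul_const ‖y‖
  refine ⟨∑' n, g (r n), tendsto_nhds_unique (hs.hasSum.mapL Q).tendsto_sum_nat ?_⟩
  simp only [hsum]
  simpa using tendsto_const_nhds.sub hr0

variable [CompleteSpace F]

theorem quotientInverse_apply (Q : E →L[𝕜] F) (hQ : Function.Surjective Q) (x : E) :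
    quotientInverse Q hQ (Q x) = Submodule.Quotient.mk x :=
  (Q : E →ₗ[𝕜] F).quotKerEquivOfSurjective_symm_apply hQ x

/-- Summing corrections would cost a factor 2. Here the quotient inverse is already known to be
continuous, so its bound at `y` follows from bounds at nearby points `Q x`, with no loss in `C`. -/
theorem inversionConstant_le_of_approx_preimage (Q : E →L[𝕜] F) (hQ : Function.Surjective Q)
    {C : ℝ} (hC : 0 ≤ C) (h : ∀ y, ∀ δ > 0, ∃ x, ‖x‖ ≤ C * ‖y‖ ∧ ‖y - Q x‖ < δ) :
    inversionConstant Q hQ ≤ C := by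
  refine ContinuousLinearMap.opNorm_le_bound _ hC fun y => ?_
  have hy : y ∈ closure {z | ‖quotientInverse Q hQ z‖ ≤ C * ‖y‖} := by
    refine Metric.mem_closure_iff.2 fun δ hδ => ?_
    obtain ⟨x, h1, h2⟩ := h y δ hδ
    refine ⟨Q x, ?_, by rwa [dist_eq_norm]⟩
    change ‖quotientInverse Q hQ (Q x)‖ ≤ C * ‖y‖
    rw [quotientInverse_apply]
    exact (Submodule.Quotient.norm_mk_le _ x).trans h1
  rwa [IsClosed.closure_eq (isClosed_le (by fun_prop) (by fun_prop))] at hy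

end Inversion

/-! ### Operators induced by elements of `A(X) ⊗̂ A(X)` -/

section Approximable

variable {𝕜 : Type*} [RCLike 𝕜]
variable {X : Type*} [NormedAddCommGroup X] [NormedSpace 𝕜 X]
variable {Y : Type*} [NormedAddCommGroup Y] [NormedSpace 𝕜 Y]
variable {Z : Type*} [NormedAddCommGroup Z] [NormedSpace 𝕜 Z]
variable {W : Type*} [NormedAddCommGroup W] [NormedSpace 𝕜 W]

theorem comp_mem_approximable_right {R : Y →L[𝕜] Z} (S : X →L[𝕜] Y)
    (hR : R ∈ approximable 𝕜 Y Z) : R.comp S ∈ approximable 𝕜 X Z := by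
  have hc : Continuous fun R : Y →L[𝕜] Z => R.comp S :=
    ((ContinuousLinearMap.compL 𝕜 X Y Z).flip S).continuous
  refine map_mem_closure (f := fun R : Y →L[𝕜] Z => R.comp S) hc hR fun R hR => ?_
  have hR' : FiniteDimensional 𝕜 (LinearMap.range (R : Y →ₗ[𝕜] Z)) := hR
  change FiniteDimensional 𝕜 (LinearMap.range ((R : Y →ₗ[𝕜] Z) ∘ₗ (S : X →ₗ[𝕜] Y)))
  exact Submodule.finiteDimensional_of_le (LinearMap.range_comp_le_range _ _)

theorem smulRight_mem_approximable (f : X →L[𝕜] 𝕜) (y : Y) :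
    f.smulRight y ∈ approximable 𝕜 X Y := by
  refine Submodule.le_topologicalClosure _ ?_
  change FiniteDimensional 𝕜 (LinearMap.range (f.smulRight y : X →ₗ[𝕜] Y))
  refine Submodule.finiteDimensional_of_le (S₂ := 𝕜 ∙ y) ?_
  rintro _ ⟨x, rfl⟩
  exact Submodule.smul_mem _ _ (Submodule.mem_span_singleton_self y)

/-- The map `A(X, Y) → A(W, Z)`, `T ↦ s ∘ T ∘ r`. -/
def sandwich (s : Y →L[𝕜] Z) (r : W →L[𝕜] X) : Approx 𝕜 X Y →L[𝕜] Approx 𝕜 W Z :=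
  LinearMap.mkContinuous
    { toFun := fun T => ⟨s.comp ((Approx.val 𝕜 X Y T).comp r),
        comp_mem_approximable_left s (comp_mem_approximable_right r T.2)⟩
      map_add' := fun S T => Subtype.ext <| by
        simp only [map_add, ContinuousLinearMap.add_comp, ContinuousLinearMap.comp_add]
        rfl
      map_smul' := fun c T => Subtype.ext <| by
        simp only [map_smul, ContinuousLinearMap.smul_comp, ContinuousLinearMap.comp_smul]
        rfl }
    (‖s‖ * ‖r‖) fun T => by
      calc ‖s.comp ((Approx.val 𝕜 X Y T).comp r)‖ ≤ ‖s‖ * (‖Approx.val 𝕜 X Y T‖ * ‖r‖) :=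
            (s.opNorm_comp_le _).trans
              (by gcongr; exact ContinuousLinearMap.opNorm_comp_le _ _)
        _ = ‖s‖ * ‖r‖ * ‖T‖ := by rw [LinearIsometry.norm_map]; ring

theorem norm_sandwich_le (s : Y →L[𝕜] Z) (r : W →L[𝕜] X) : ‖sandwich s r‖ ≤ ‖s‖ * ‖r‖ :=
  LinearMap.mkContinuous_norm_le _ (by positivity) _

/-- Pointwise convergence of a bounded family to a scalar operator is norm convergence after
composition with an approximable operator. -/
theorem tendsto_comp_of_tendsto_apply {ι : Type*} {l : Filter ι} {M : ι → X →L[𝕜] X} {C : ℝ}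
    (hM : ∀ i, ‖M i‖ ≤ C) {c : 𝕜} (h : ∀ x, Filter.Tendsto (fun i => M i x) l (𝓝 (c • x)))
    {a : Y →L[𝕜] X} (ha : a ∈ approximable 𝕜 Y X) :
    Filter.Tendsto (fun i => (M i).comp a) l (𝓝 (c • a)) := by
  -- For finite rank, `b` is a finite sum of rank-one operators, so only the finitely many vectors
  -- `e j` have to converge.
  have hfin : ∀ b ∈ finiteRank 𝕜 Y X,
      Filter.Tendsto (fun i => (M i).comp b) l (𝓝 (c • b)) := by
    intro b hb
    have hb' : FiniteDimensional 𝕜 (LinearMap.range (b : Y →ₗ[𝕜] X)) := hb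
    let e := Module.finBasis 𝕜 (LinearMap.range (b : Y →ₗ[𝕜] X))
    let b' : Y →L[𝕜] LinearMap.range (b : Y →ₗ[𝕜] X) :=
      b.codRestrict _ fun y => LinearMap.mem_range_self _ y
    let f : Fin _ → Y →L[𝕜] 𝕜 := fun j => (LinearMap.toContinuousLinearMap (e.coord j)).comp b'
    have hbs : b = ∑ j, (f j).smulRight (e j : X) := by
      ext y
      have := congrArg Subtype.val (e.sum_repr (b' y))
      rw [AddSubmonoidClass.coe_finsetSum] at this
      simp only [sum_apply, ContinuousLinearMap.smulRight_apply]
      exact this.symm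
    have hMb : ∀ i, (M i).comp b = ∑ j, (f j).smulRight (M i (e j : X)) := by
      intro i
      conv_lhs => rw [hbs]
      ext y
      simp
    have hcb : c • b = ∑ j, (f j).smulRight (c • (e j : X)) := by
      conv_lhs => rw [hbs]
      ext y
      simp [Finset.smul_sum, smul_comm c]
    simp only [hMb, hcb]
    refine tendsto_finsetSum _ fun j _ => ?_
    exact ((ContinuousLinearMap.smulRightL 𝕜 Y X (f j)).continuous.tendsto _).comp (h _)
  rw [Metric.tendsto_nhds]
  intro ε hε
  have hC : 0 < |C| + ‖c‖ + 1 := by positivity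
  -- Replacing `a` by `b` costs at most (|C| + ‖c‖)‖a - b‖ uniformly in `i`; the added 1 keeps the
  -- denominator positive.
  obtain ⟨b, hb, hab⟩ := Metric.mem_closure_iff.1 ha (ε / 2 / (|C| + ‖c‖ + 1)) (by positivity)
  filter_upwards [Metric.tendsto_nhds.1 (hfin b hb) (ε / 2) (by positivity)] with i hi
  rw [dist_eq_norm] at hi hab ⊢
  rw [lt_div_iff₀ hC] at hab
  have hsplit : (M i).comp a - c • a =
      (M i).comp (a - b) - c • (a - b) + ((M i).comp b - c • b) := by
    rw [ContinuousLinearMap.comp_sub, smul_sub]; abel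
  have h1 : ‖(M i).comp (a - b)‖ ≤ |C| * ‖a - b‖ :=
    ((M i).opNorm_comp_le _).trans (by gcongr; exact (hM i).trans (le_abs_self C))
  have h2 : ‖c • (a - b)‖ = ‖c‖ * ‖a - b‖ := norm_smul _ _
  calc ‖(M i).comp a - c • a‖
      ≤ ‖(M i).comp (a - b)‖ + ‖c • (a - b)‖ + ‖(M i).comp b - c • b‖ := by
        rw [hsplit]
        exact (norm_add_le _ _).trans (by gcongr; exact norm_sub_le _ _)
    _ < ε := by nlinarith [norm_nonneg (a - b)]

variable [CompleteSpace X]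

/-- The map `A(X) ⊗̂ A(X) → L(X)`, `a ⊗ b ↦ a ∘ T ∘ b`. -/
def middle (T : X →L[𝕜] X) :
    ProjTensor 𝕜 (Approx 𝕜 X X) (Approx 𝕜 X X) →L[𝕜] X →L[𝕜] X :=
  lift ((ContinuousLinearMap.compL 𝕜 X X X).bilinearComp
    (Approx.val 𝕜 X X).toContinuousLinearMap
    ((ContinuousLinearMap.compL 𝕜 X X X T).comp (Approx.val 𝕜 X X).toContinuousLinearMap))

theorem middle_ptmul (T : X →L[𝕜] X) (a b : Approx 𝕜 X X) :
    middle T (ptmul 𝕜 a b) = (Approx.val 𝕜 X X a).comp (T.comp (Approx.val 𝕜 X X b)) :=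
  lift_ptmul _ a b

/-- With `middle_rightAct`, this turns asymptotic centrality of the diagonal into asymptotic
commutation of operators. -/
theorem middle_leftAct (T : X →L[𝕜] X) (a : Approx 𝕜 X X)
    (d : ProjTensor 𝕜 (Approx 𝕜 X X) (Approx 𝕜 X X)) :
    middle T (leftAct 𝕜 a d) = (Approx.val 𝕜 X X a).comp (middle T d) := by
  refine DFunLike.congr_fun (f := (middle T).comp (leftAct 𝕜 a))
    (g := (ContinuousLinearMap.compL 𝕜 X X X (Approx.val 𝕜 X X a)).comp (middle T))
    (projTensor_ext fun b c => ?_) d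
  simp only [ContinuousLinearMap.comp_apply, leftAct_ptmul, middle_ptmul,
    ContinuousLinearMap.compL_apply]
  rfl

theorem middle_rightAct (T : X →L[𝕜] X) (a : Approx 𝕜 X X)
    (d : ProjTensor 𝕜 (Approx 𝕜 X X) (Approx 𝕜 X X)) :
    middle T (rightAct 𝕜 a d) = (middle T d).comp (Approx.val 𝕜 X X a) := by
  refine DFunLike.congr_fun (f := (middle T).comp (rightAct 𝕜 a))
    (g := ((ContinuousLinearMap.compL 𝕜 X X X).flip (Approx.val 𝕜 X X a)).comp (middle T))
    (projTensor_ext fun b c => ?_) d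
  simp only [ContinuousLinearMap.comp_apply, rightAct_ptmul, middle_ptmul,
    ContinuousLinearMap.flip_apply, ContinuousLinearMap.compL_apply]
  rfl

theorem middle_one (d : ProjTensor 𝕜 (Approx 𝕜 X X) (Approx 𝕜 X X)) :
    middle 1 d = Approx.val 𝕜 X X (mulMap 𝕜 (Approx 𝕜 X X) d) := by
  refine DFunLike.congr_fun (f := middle 1)
    (g := (Approx.val 𝕜 X X).toContinuousLinearMap.comp (mulMap 𝕜 (Approx 𝕜 X X)))
    (projTensor_ext fun b c => ?_) d
  rw [middle_ptmul, ContinuousLinearMap.comp_apply, mulMap, lift_ptmul]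
  rfl

theorem middle_add (S T : X →L[𝕜] X) (d : ProjTensor 𝕜 (Approx 𝕜 X X) (Approx 𝕜 X X)) :
    middle (S + T) d = middle S d + middle T d := by
  refine DFunLike.congr_fun (f := middle (S + T)) (g := middle S + middle T)
    (projTensor_ext fun b c => ?_) d
  simp [middle_ptmul]

/-- An asymptotically central bounded family in `A(X) ⊗̂ A(X)` induces, along an ultrafilter,
operators that converge pointwise to a scalar multiple of the identity. -/
theorem exists_tendsto_middle_apply {ι : Type*} (l : Ultrafilter ι)
    {d : ι → ProjTensor 𝕜 (Approx 𝕜 X X) (Approx 𝕜 X X)} {K : ℝ} (hK : ∀ i, ‖d i‖ ≤ K)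
    (hd : ∀ a, Filter.Tendsto (fun i => leftAct 𝕜 a (d i) - rightAct 𝕜 a (d i)) l (𝓝 0))
    (T : X →L[𝕜] X) :
    ∃ c : 𝕜, ∀ x, Filter.Tendsto (fun i => middle T (d i) x) l (𝓝 (c • x)) := by
  rcases subsingleton_or_nontrivial X with hX | hX
  · refine ⟨0, fun x => ?_⟩
    simpa only [Subsingleton.elim _ (0 : X)] using tendsto_const_nhds
  obtain ⟨x₀, hx₀⟩ := exists_ne (0 : X)
  obtain ⟨f, hf⟩ := SeparatingDual.exists_eq_one (R := 𝕜) hx₀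
  have hbound : ∀ i, f (middle T (d i) x₀) ∈
      Metric.closedBall (0 : 𝕜) (‖f‖ * (‖middle (𝕜 := 𝕜) T‖ * K * ‖x₀‖)) := by
    intro i
    rw [mem_closedBall_zero_iff]
    refine (f.le_opNorm _).trans ?_
    gcongr
    refine ((middle T (d i)).le_opNorm _).trans ?_
    gcongr
    exact ((middle T).le_opNorm _).trans (by gcongr; exact hK i)
  -- The scalars stay in a compact ball, so the ultrafilter picks a limit that depends on `x₀` and
  -- `f` but not on `x`.
  obtain ⟨c, -, hc⟩ := (isCompact_closedBall (0 : 𝕜) _).ultrafilter_le_nhds'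
    (l.map fun i => f (middle T (d i) x₀)) (Filter.Eventually.of_forall (f := (l : Filter ι)) hbound)
  replace hc : Filter.Tendsto (fun i => f (middle T (d i) x₀)) l (𝓝 c) := hc
  refine ⟨c, fun x => ?_⟩
  -- The commutator of `a` with an operator M, evaluated at `x₀`, is f(M x₀) x - M x, because f(x₀)
  -- = 1.
  let a : Approx 𝕜 X X := ⟨f.smulRight x, smulRight_mem_approximable f x⟩
  have ha : Approx.val 𝕜 X X a = f.smulRight x := rfl
  have hcomm : Filter.Tendsto (fun i => f (middle T (d i) x₀) • x - middle T (d i) x) l (𝓝 0) := by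
    have h1 := (((ContinuousLinearMap.apply 𝕜 X x₀).comp (middle T)).continuous.tendsto 0).comp
      (hd a)
    simpa [Function.comp_def, middle_leftAct, middle_rightAct, ha, hf] using h1
  simpa using (hc.smul_const x).sub hcomm

variable [CompleteSpace Y]

/-- If a family of norm at most `K` in `A(X) ⊗̂ A(X)` induces, through `Z`, operators that converge
pointwise to `c • id` with `‖c‖ ≥ 1 / 2`, then the product map onto `A(Y)` is surjective for every
complemented subspace `Y` of `X`. -/
theorem exists_inversionConstant_productMap_le {ι : Type*} {l : Filter ι} [l.NeBot]
    {d : ι → ProjTensor 𝕜 (Approx 𝕜 X X) (Approx 𝕜 X X)} {K : ℝ} (hK : ∀ i, ‖d i‖ ≤ K)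
    {iY : Y →L[𝕜] X} {pY : X →L[𝕜] Y} {iZ : Z →L[𝕜] X} {pZ : X →L[𝕜] Z}
    (hY : ∀ y, pY (iY y) = y) (hiY : ‖iY‖ ≤ 1) (hiZ : ‖iZ‖ ≤ 1) {c : 𝕜} (hc : 1 / 2 ≤ ‖c‖)
    (h : ∀ x, Filter.Tendsto (fun i => middle (iZ.comp pZ) (d i) x) l (𝓝 (c • x))) :
    ∃ hs : Function.Surjective (productMap 𝕜 Y Z),
      inversionConstant (productMap 𝕜 Y Z) hs ≤ 2 * K * ‖pY‖ * ‖pZ‖ := by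
  have hK0 : 0 ≤ K := by
    obtain ⟨i⟩ := l.nonempty_of_neBot
    exact (norm_nonneg _).trans (hK i)
  have hc0 : c ≠ 0 := by rintro rfl; norm_num at hc
  have happrox : ∀ a : Approx 𝕜 Y Y, ∀ δ > 0, ∃ t,
      ‖t‖ ≤ 2 * K * ‖pY‖ * ‖pZ‖ * ‖a‖ ∧ ‖a - productMap 𝕜 Y Z t‖ < δ := by
    intro a δ hδ
    let ia : Y →L[𝕜] X := iY.comp (Approx.val 𝕜 Y Y a)
    have hia : ‖ia‖ ≤ ‖a‖ := by
      refine (iY.opNorm_comp_le _).trans ?_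
      rw [LinearIsometry.norm_map]
      exact mul_le_of_le_one_left (norm_nonneg _) hiY
    -- `B` is (R, S) ↦ (pY R iZ) ⊗ (pZ S iY a): the middle operator iZ pZ is split between the two
    -- factors, and the target `a` is absorbed into the second.
    let B := (ptmulL 𝕜 (Approx 𝕜 Z Y) (Approx 𝕜 Y Z)).bilinearComp
      (sandwich (X := X) (Y := X) pY iZ) (sandwich (X := X) (Y := X) pZ ia)
    have hB : ‖B‖ ≤ ‖pY‖ * ‖pZ‖ * ‖a‖ := by
      refine ContinuousLinearMap.opNorm_le_bound₂ _ (by positivity) fun R S => ?_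
      calc ‖ptmul 𝕜 (sandwich pY iZ R) (sandwich pZ ia S)‖
          ≤ ‖sandwich pY iZ R‖ * ‖sandwich pZ ia S‖ := norm_ptmul_le _ _
        _ ≤ (‖pY‖ * ‖iZ‖ * ‖R‖) * (‖pZ‖ * ‖ia‖ * ‖S‖) := by
          gcongr
          · exact (sandwich pY iZ).le_of_opNorm_le (norm_sandwich_le _ _) R
          · exact (sandwich pZ ia).le_of_opNorm_le (norm_sandwich_le _ _) S
        _ ≤ (‖pY‖ * 1 * ‖R‖) * (‖pZ‖ * ‖a‖ * ‖S‖) := by gcongr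
        _ = ‖pY‖ * ‖pZ‖ * ‖a‖ * ‖R‖ * ‖S‖ := by ring
    have hprod : ∀ t, Approx.val 𝕜 Y Y (productMap 𝕜 Y Z (lift B t)) =
        pY.comp ((middle (iZ.comp pZ) t).comp ia) := by
      intro t
      refine DFunLike.congr_fun
        (f := (Approx.val 𝕜 Y Y).toContinuousLinearMap.comp ((productMap 𝕜 Y Z).comp (lift B)))
        (g := (ContinuousLinearMap.compL 𝕜 Y X Y pY).comp
          (((ContinuousLinearMap.compL 𝕜 Y X X).flip ia).comp (middle (iZ.comp pZ))))
        (projTensor_ext fun R S => ?_) t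
      have hBRS : B R S = ptmul 𝕜 (sandwich pY iZ R) (sandwich pZ ia S) := rfl
      simp only [ContinuousLinearMap.comp_apply, lift_ptmul, hBRS, productMap_ptmul,
        middle_ptmul, ContinuousLinearMap.flip_apply, ContinuousLinearMap.compL_apply]
      rfl
    -- The products are c⁻¹ pY Mᵢ iY a with Mᵢ → c pointwise. Since iY a is approximable, the
    -- convergence is in norm, and pY iY = id leaves `a`.
    have hlim : Filter.Tendsto
        (fun i => Approx.val 𝕜 Y Y (productMap 𝕜 Y Z (c⁻¹ • lift B (d i)))) l
        (𝓝 (Approx.val 𝕜 Y Y a)) := by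
      have h1 := tendsto_comp_of_tendsto_apply (C := ‖middle (𝕜 := 𝕜) (iZ.comp pZ)‖ * K)
        (fun i => ((middle (iZ.comp pZ)).le_opNorm (d i)).trans (by gcongr; exact hK i)) h
        (a := ia) (comp_mem_approximable_left iY a.2)
      have h2 := (((ContinuousLinearMap.compL 𝕜 Y X Y pY).continuous.tendsto _).comp h1).const_smul
        c⁻¹
      have h3 : c⁻¹ • pY.comp (c • ia) = Approx.val 𝕜 Y Y a := by
        ext y
        simp [ia, hY, smul_smul, hc0]
      simp only [map_smul, hprod]
      rw [← h3]
      exact h2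
    obtain ⟨i, hi⟩ := ((Metric.tendsto_nhds.1 hlim) δ hδ).exists
    refine ⟨c⁻¹ • lift B (d i), ?_, ?_⟩
    · have hc2 : ‖c⁻¹‖ ≤ 2 := by
        rw [norm_inv]
        exact inv_le_of_inv_le₀ (by norm_num) (by simpa using hc)
      calc ‖c⁻¹ • lift B (d i)‖ = ‖c⁻¹‖ * ‖lift B (d i)‖ := norm_smul _ _
        _ ≤ 2 * (‖pY‖ * ‖pZ‖ * ‖a‖ * K) := by
          gcongr
          exact (norm_lift_apply_le B _).trans (by gcongr; exact hK i)
        _ = _ := by ring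
    · rwa [dist_comm, dist_eq_norm, ← map_sub, LinearIsometry.norm_map] at hi
  have hs := surjective_of_approx_preimage _ _ happrox
  exact ⟨hs, inversionConstant_le_of_approx_preimage _ hs (by positivity) happrox⟩

theorem exists_inversionConstant_productMap_le_of_subsingleton [Subsingleton Y] {C : ℝ}
    (hC : 0 ≤ C) :
    ∃ hs : Function.Surjective (productMap 𝕜 Y Z),
      inversionConstant (productMap 𝕜 Y Z) hs ≤ C := by
  have : Subsingleton (Approx 𝕜 Y Y) :=
    (Approx.val_injective (𝕜 := 𝕜) (X := Y) (Y := Y)).subsingleton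
  refine ⟨fun a => ⟨0, Subsingleton.elim _ _⟩, ?_⟩
  refine ContinuousLinearMap.opNorm_le_bound _ hC fun a => ?_
  rw [Subsingleton.elim a 0]
  simp

end Approximable

/-! ### Norms of projections and the main theorem -/

theorem one_le_norm_of_isIdempotentElem {R : Type*} [NormedRing R] {p : R}
    (hp : IsIdempotentElem p) (h0 : p ≠ 0) : 1 ≤ ‖p‖ := by
  have h := norm_mul_le p p
  rw [hp.eq] at h
  exact le_of_mul_le_mul_right (by simpa using h) (norm_pos_iff.2 h0)

theorem norm_rangeRestrict_le {𝕜 : Type*} [RCLike 𝕜] {X : Type*} [NormedAddCommGroup X]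
    [NormedSpace 𝕜 X] (P : X →L[𝕜] X) : ‖P.rangeRestrict‖ ≤ ‖P‖ :=
  ContinuousLinearMap.opNorm_le_bound _ (norm_nonneg P) fun x => P.le_opNorm x

end ApproxOp

end

open ApproxOp in
theorem mainTheorem5 {𝕜 : Type*} [RCLike 𝕜] {X : Type*} [NormedAddCommGroup X] [NormedSpace 𝕜 X]
    [CompleteSpace X] (P : X →L[𝕜] X) (hP : IsIdempotentElem P) (K : ℝ)
    (hK : IsKAmenable 𝕜 (Approx 𝕜 X X) K) :
    haveI : CompleteSpace (rg P) := completeSpace_rg hP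
    haveI : CompleteSpace (rg (1 - P)) := completeSpace_rg hP.one_sub
    (∃ h : Function.Surjective (productMap 𝕜 (rg P) (rg (1 - P))),
      inversionConstant (productMap 𝕜 (rg P) (rg (1 - P))) h
        ≤ 4 * K * ‖P‖ * ‖1 - P‖ * max (‖P‖ ^ 3) (‖1 - P‖ ^ 3)) ∨
    (∃ h : Function.Surjective (productMap 𝕜 (rg (1 - P)) (rg P)),
      inversionConstant (productMap 𝕜 (rg (1 - P)) (rg P)) h
        ≤ 4 * K * ‖P‖ * ‖1 - P‖ * max (‖P‖ ^ 3) (‖1 - P‖ ^ 3)) := by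
  have : CompleteSpace (rg P) := completeSpace_rg hP
  have : CompleteSpace (rg (1 - P)) := completeSpace_rg hP.one_sub
  obtain ⟨ι, _, _, _, d, hd, hπ, hcomm⟩ := hK
  have hK0 : 0 ≤ K := (norm_nonneg _).trans (hd (Classical.arbitrary ι))
  have hC0 : 0 ≤ 4 * K * ‖P‖ * ‖1 - P‖ * max (‖P‖ ^ 3) (‖1 - P‖ ^ 3) :=
    mul_nonneg (by positivity) (le_max_of_le_left (by positivity))
  -- If one range is trivial, the product map onto its zero algebra is surjective with inversion
  -- constant 0. Otherwise P ≠ 0 provides ‖P‖ ≥ 1 and a nonzero vector.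
  rcases eq_or_ne P 0 with hP0 | hP0
  · have : Subsingleton (rg P) := by
      refine Submodule.subsingleton_iff_eq_bot.2 (LinearMap.range_eq_bot.2 ?_)
      rw [hP0]; rfl
    exact .inl (exists_inversionConstant_productMap_le_of_subsingleton hC0)
  rcases eq_or_ne (1 - P) 0 with hQ0 | hQ0
  · have : Subsingleton (rg (1 - P)) := by
      refine Submodule.subsingleton_iff_eq_bot.2 (LinearMap.range_eq_bot.2 ?_)
      rw [hQ0]; rfl
    exact .inr (exists_inversionConstant_productMap_le_of_subsingleton hC0)
  have hP1 := one_le_norm_of_isIdempotentElem hP hP0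
  obtain ⟨x₀, hx₀⟩ : ∃ x, P x ≠ 0 := by
    by_contra! h
    exact hP0 (ContinuousLinearMap.ext h)
  replace hx₀ : x₀ ≠ 0 := by rintro rfl; simp at hx₀
  -- A single ultrafilter serves both `P` and `1 - P`, so that the two limits can be added.
  let l : Ultrafilter ι := .of Filter.atTop
  have hl : (l : Filter ι) ≤ Filter.atTop := Ultrafilter.of_le _
  obtain ⟨c, hc⟩ := exists_tendsto_middle_apply l hd (fun a => (hcomm a).mono_left hl) P
  obtain ⟨c', hc'⟩ := exists_tendsto_middle_apply l hd (fun a => (hcomm a).mono_left hl) (1 - P)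
  have hcc : c + c' = 1 := by
    obtain ⟨f, hf⟩ := SeparatingDual.exists_eq_one (R := 𝕜) hx₀
    -- `a` fixes `x₀`, so π(d i) a → a gives π(d i) x₀ → x₀.
    let a : Approx 𝕜 X X := ⟨f.smulRight x₀, smulRight_mem_approximable f x₀⟩
    have ha : Approx.val 𝕜 X X a x₀ = x₀ := by
      change f x₀ • x₀ = x₀
      rw [hf, one_smul]
    have h1 : Filter.Tendsto (fun i => middle 1 (d i) x₀) l (𝓝 x₀) := by
      have h2 := ((((ContinuousLinearMap.apply 𝕜 X x₀).comp
        (Approx.val 𝕜 X X).toContinuousLinearMap).continuous.tendsto a).comp (hπ a)).mono_left hl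
      have h3 : ∀ b, Approx.val 𝕜 X X (b * a) x₀ = Approx.val 𝕜 X X b x₀ := fun b => by
        rw [Approx.mul_eq_comp, Approx.val_comp, ContinuousLinearMap.comp_apply, ha]
      simpa [Function.comp_def, h3, ha, middle_one] using h2
    have h2 : Filter.Tendsto (fun i => middle 1 (d i) x₀) l (𝓝 ((c + c') • x₀)) := by
      have h3 : (1 : X →L[𝕜] X) = P + (1 - P) := by abel
      rw [h3, add_smul]
      simpa only [middle_add, add_apply] using (hc x₀).add (hc' x₀)
    have h3 := tendsto_nhds_unique h2 h1
    exact smul_left_injective 𝕜 hx₀ (by simpa using h3)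
  -- The argument yields the smaller constant 2K‖P‖‖1 - P‖; the maximum is at least 1 because ‖P‖ ≥
  -- 1.
  have hle : ∀ S T : ℝ, 0 ≤ S → 0 ≤ T → S ≤ ‖P‖ → T ≤ ‖1 - P‖ → 2 * K * S * T ≤
      4 * K * ‖P‖ * ‖1 - P‖ * max (‖P‖ ^ 3) (‖1 - P‖ ^ 3) := fun S T hS hT hSP hTP =>
    calc 2 * K * S * T ≤ 4 * K * ‖P‖ * ‖1 - P‖ := by gcongr; norm_num
      _ ≤ _ := le_mul_of_one_le_right (by positivity) (le_max_of_le_left (one_le_pow₀ hP1))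
  have hret : ∀ {R : X →L[𝕜] X}, IsIdempotentElem R → ∀ y : rg R, R.rangeRestrict (y : X) = y := by
    rintro R hR ⟨_, y, rfl⟩
    exact Subtype.ext (DFunLike.congr_fun hR.eq y)
  have hcase : 1 / 2 ≤ ‖c'‖ ∨ 1 / 2 ≤ ‖c‖ := by
    by_contra! h
    have h1 := norm_add_le c c'
    rw [hcc, norm_one] at h1
    linarith
  rcases hcase with h | h
  -- The scalar `c'` belongs to `1 - P`, whose operators factor through `rg (1 - P)`; it therefore
  -- controls the product map onto A(`rg P`).
  · left
    obtain ⟨hs, hb⟩ := exists_inversionConstant_productMap_le (l := (l : Filter ι)) hd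
      (iY := (rg P).subtypeL) (pY := P.rangeRestrict)
      (iZ := (rg (1 - P)).subtypeL) (pZ := (1 - P).rangeRestrict)
      (hret hP) (Submodule.norm_subtypeL_le _) (Submodule.norm_subtypeL_le _) h hc'
    exact ⟨hs, hb.trans (hle _ _ (norm_nonneg _) (norm_nonneg _) (norm_rangeRestrict_le P)
      (norm_rangeRestrict_le _))⟩
  · right
    obtain ⟨hs, hb⟩ := exists_inversionConstant_productMap_le (l := (l : Filter ι)) hd
      (iY := (rg (1 - P)).subtypeL) (pY := (1 - P).rangeRestrict)
      (iZ := (rg P).subtypeL) (pZ := P.rangeRestrict)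
      (hret hP.one_sub) (Submodule.norm_subtypeL_le _) (Submodule.norm_subtypeL_le _) h hc
    refine ⟨hs, hb.trans ?_⟩
    rw [mul_right_comm]
    exact hle _ _ (norm_nonneg _) (norm_nonneg _) (norm_rangeRestrict_le P)
      (norm_rangeRestrict_le _)
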